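/- Write $\mathcal N_2$ for the class of nilpotent groups of class at most two (groups $G$ with $G'=[G,G]\subseteq Z(G)$) and $\mathcal B_m$ for the class of groups satisfying $x^m=e$ identically. An amalgam of $\mathcal C$-groups with core $G$ consists of $\mathcal C$-groups $A$, $C$ and one-to-one morphisms $\Phi_A\colon G\to A$, $\Phi_C\colon G\to C$, where $G\in\mathcal C$. It is weakly embeddable in $\mathcal D$ if there are $M\in\mathcal D$ and one-to-one morphisms $\lambda_A\colon A\to M$, $\lambda_C\colon C\to M$ with $\lambda_A\Phi_A=\lambda_C\Phi_C$; it is strongly embeddable in $\mathcal D$ if these can be chosen so that in addition $\lambda_A(A)\cap\lambda_C(C)=\lambda_A\Phi_A(G)$. A group $G\in\mathcal C$ is a weak (strong) amalgamation base for $\mathcal C$ if every amalgam of $\mathcal C$-groups with core $G$ is weakly (strongly) embeddable in $\mathcal C$. For $m>0$, $G^m$ denotes the subgroup of $G$ generated by all $m$-th powers, and an $\mathcal N_2$-extension of $G$ is a group in $\mathcal N_2$ containing $G$ as a subgroup. Theorem. Let $n>0$ and let $G\in\mathcal N_2\cap\mathcal B_{2^{n+1}}$. The following are equivalent: (i) $G$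 is a weak amalgamation base for $\mathcal N_2$. (ii) Every amalgam of $\mathcal N_2\cap\mathcal B_{2^{n+2}}$-groups with core $G$ is weakly embeddable in $\mathcal N_2$. (iii) $G'=Z(G)$, and for every $g\in G$ and every $i$ with $1\le i\le n$, either $g\in G^{2^i}G'$ or no $\mathcal N_2$-extension of $G$ contains a $2^i$-th root of $g$. (iv) Every amalgam of $\mathcal N_2\cap\mathcal B_{2^{n+2}}$-groups with core $G$ is strongly embeddable in $\mathcal N_2$. (v) $G$ is a strong amalgamation base for $\mathcal N_2$. -/

import Mathlib

universe u

/-- `G` is nilpotent of class at most two: `[G, G] ⊆ Z(G)`. -/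
def IsNil2 (G : Type u) [Group G] : Prop :=
  commutator G ≤ Subgroup.center G

/-- `G` is nilpotent of class at most two and satisfies the identity `x ^ m = 1`. -/
def IsNil2Exp (m : ℕ) (G : Type u) [Group G] : Prop :=
  IsNil2 G ∧ ∀ x : G, x ^ m = 1

/-- The amalgam of `A` and `C` with core `B`, given by `φA : B →* A` and `φC : B →* C`, is weakly
embeddable in the class `𝒟`: there are a `𝒟`-group `M` and one-to-one morphisms from `A` and `C`
to `M` that agree on `B`. -/
def WeaklyEmbeddable (𝒟 : ∀ (M : Type u) [Group M], Prop) {A B C : Type u}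
    [Group A] [Group B] [Group C] (φA : B →* A) (φC : B →* C) : Prop :=
  ∃ (M : Type u) (_ : Group M) (lA : A →* M) (lC : C →* M),
    𝒟 M ∧ Function.Injective lA ∧ Function.Injective lC ∧ lA.comp φA = lC.comp φC

/-- Strong embeddability: moreover the images of `A` and `C` in `M` meet exactly in the common
image of `B`, so that no element of `A \ B` is identified with an element of `C \ B`. -/
def StronglyEmbeddable (𝒟 : ∀ (M : Type u) [Group M], Prop) {A B C : Type u}
    [Group A] [Group B] [Group C] (φA : B →* A) (φC : B →* C) : Prop :=
  ∃ (M : Type u) (_ : Group M) (lA : A →* M) (lC : C →* M),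
    𝒟 M ∧ Function.Injective lA ∧ Function.Injective lC ∧ lA.comp φA = lC.comp φC ∧
      lA.range ⊓ lC.range = (lA.comp φA).range

/-- Every amalgam of `𝒞`-groups with core `G` is weakly embeddable in `𝒟`. -/
def AmalgamsWeaklyEmbed (𝒞 𝒟 : ∀ (M : Type u) [Group M], Prop) (G : Type u) [Group G] : Prop :=
  ∀ (A C : Type u) [Group A] [Group C] (φA : G →* A) (φC : G →* C), 𝒞 A → 𝒞 C →
    Function.Injective φA → Function.Injective φC → WeaklyEmbeddable 𝒟 φA φC

/-- Every amalgam of `𝒞`-groups with core `G` is strongly embeddable in `𝒟`. -/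
def AmalgamsStronglyEmbed (𝒞 𝒟 : ∀ (M : Type u) [Group M], Prop) (G : Type u) [Group G] : Prop :=
  ∀ (A C : Type u) [Group A] [Group C] (φA : G →* A) (φC : G →* C), 𝒞 A → 𝒞 C →
    Function.Injective φA → Function.Injective φC → StronglyEmbeddable 𝒟 φA φC

/-- `G` is a weak amalgamation base for the class `𝒞`. -/
def IsWeakBase (𝒞 : ∀ (M : Type u) [Group M], Prop) (G : Type u) [Group G] : Prop :=
  𝒞 G ∧ AmalgamsWeaklyEmbed 𝒞 𝒞 G

/-- `G` is a strong amalgamation base for the class `𝒞`. -/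
def IsStrongBase (𝒞 : ∀ (M : Type u) [Group M], Prop) (G : Type u) [Group G] : Prop :=
  𝒞 G ∧ AmalgamsStronglyEmbed 𝒞 𝒞 G

/-- The subgroup `G ^ m G'`, where `G ^ m` is generated by the `m`-th powers. -/
def powMulCommutator (G : Type u) [Group G] (m : ℕ) : Subgroup G :=
  Subgroup.closure (Set.range fun x : G => x ^ m) ⊔ commutator G

/-- Some extension of `G` that is nilpotent of class at most two contains an `m`-th root of `g`. -/
def HasRootInNil2Extension {G : Type u} [Group G] (m : ℕ) (g : G) : Prop :=
  ∃ (K : Type u) (_ : Group K) (φ : G →* K),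
    IsNil2 K ∧ Function.Injective φ ∧ ∃ r : K, r ^ m = φ g

open scoped commutatorElement IsMulCommutative

/-! Write N = 2^(n+1). The link between the two sides of the equivalence is a map from each
extension `A` of `G` onto the abelianization of `G`, extending the canonical map of `G`.

Condition (iii) makes G^ab → A^ab pure for every class-two extension A. Since G^ab has bounded
exponent, it splits off (`exists_retraction_of_pure`), which gives the required map
(`exists_retraction`). Given such maps on A and C, a bilinear central twist of A × C makes the
antidiagonal copy of G normal, and the quotient embeds the amalgam strongly
(`stronglyEmbeddable_of_retraction`).

Conversely, let g [x,y] = a^q in one extension, with a, x, y of exponent N. If g ∉ G^q G', another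
extension has c with c^q = 1 and [c,g] ≠ 1. In a common overgroup [c,g] = [c,a^q] = [c^q,a] = 1, a
contradiction (`mem_powMulCommutator_of_root`). Elements of exponent N generate a group of exponent
2N = 2^(n+2), so the restricted amalgams suffice. Both clauses of (iii) follow by choosing a, x, y.
-/

theorem isNil2_iff {K : Type*} [Group K] :
    IsNil2 K ↔ ∀ x y z : K, ⁅x, y⁆ * z = z * ⁅x, y⁆ := by
  unfold IsNil2
  rw [commutator_def, Subgroup.commutator_le]
  constructor
  · intro h x y z
    exact (Subgroup.mem_center_iff.1 (h x trivial y trivial) z).symm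
  · intro h x _ y _
    exact Subgroup.mem_center_iff.2 fun z => (h x y z).symm

/-! ### Commutator calculus in class at most two -/

namespace IsNil2

theorem comm {K : Type*} [Group K] (h : IsNil2 K) (x y z : K) : ⁅x, y⁆ * z = z * ⁅x, y⁆ :=
  isNil2_iff.1 h x y z

theorem of_injective {K L : Type*} [Group K] [Group L] (h : IsNil2 L) (f : K →* L)
    (hf : Function.Injective f) : IsNil2 K :=
  isNil2_iff.2 fun x y z => hf <| by
    simp only [map_mul, map_commutatorElement]
    exact h.comm _ _ _

theorem of_surjective {K L : Type*} [Group K] [Group L] (h : IsNil2 K) (f : K →* L)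
    (hf : Function.Surjective f) : IsNil2 L := by
  refine isNil2_iff.2 fun x y z => ?_
  obtain ⟨x, rfl⟩ := hf x
  obtain ⟨y, rfl⟩ := hf y
  obtain ⟨z, rfl⟩ := hf z
  simp only [← map_mul, ← map_commutatorElement, h.comm]

theorem prod {K L : Type*} [Group K] [Group L] (hK : IsNil2 K) (hL : IsNil2 L) :
    IsNil2 (K × L) :=
  isNil2_iff.2 fun x y z => Prod.ext (hK.comm x.1 y.1 z.1) (hL.comm x.2 y.2 z.2)

theorem of_commGroup {K : Type*} [CommGroup K] : IsNil2 K :=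
  isNil2_iff.2 fun _ _ _ => mul_comm _ _

variable {K : Type*} [Group K] (h : IsNil2 K)
include h

theorem comm_mem_center (x y : K) : ⁅x, y⁆ ∈ Subgroup.center K :=
  Subgroup.mem_center_iff.2 fun z => (h.comm x y z).symm

theorem comm_mul_left (x y z : K) : ⁅x * y, z⁆ = ⁅x, z⁆ * ⁅y, z⁆ := by
  have e : ⁅x * y, z⁆ = x * ⁅y, z⁆ * x⁻¹ * ⁅x, z⁆ := by
    simp only [commutatorElement_def]; group
  rw [e, ← h.comm y z x, mul_inv_cancel_right, h.comm]

theorem comm_mul_right (x y z : K) : ⁅x, y * z⁆ = ⁅x, y⁆ * ⁅x, z⁆ := by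
  rw [← commutatorElement_inv, h.comm_mul_left, mul_inv_rev, commutatorElement_inv,
    commutatorElement_inv, h.comm]

theorem comm_pow_left (x z : K) (m : ℕ) : ⁅x ^ m, z⁆ = ⁅x, z⁆ ^ m := by
  induction m with
  | zero => simp
  | succ m ih => rw [pow_succ, h.comm_mul_left, ih, pow_succ]

theorem comm_pow_right (x z : K) (m : ℕ) : ⁅x, z ^ m⁆ = ⁅x, z⁆ ^ m := by
  induction m with
  | zero => simp
  | succ m ih => rw [pow_succ, h.comm_mul_right, ih, pow_succ]

theorem comm_inv_left (x z : K) : ⁅x⁻¹, z⁆ = ⁅x, z⁆⁻¹ := by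
  rw [eq_inv_iff_mul_eq_one, ← h.comm_mul_left]; simp

theorem comm_inv_right (x z : K) : ⁅x, z⁻¹⁆ = ⁅x, z⁆⁻¹ := by
  rw [eq_inv_iff_mul_eq_one, ← h.comm_mul_right]; simp

theorem mul_pow (x y : K) (m : ℕ) : (x * y) ^ m = x ^ m * y ^ m * ⁅y, x⁆ ^ (m.choose 2) := by
  induction m with
  | zero => simp
  | succ m ih =>
    have hc : ∀ k (z : K), Commute (⁅y, x⁆ ^ k) z := fun k z =>
      Commute.pow_left (h.comm y x z) k
    have e : y ^ m * x = x * y ^ m * ⁅y, x⁆ ^ m := by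
      rw [← (hc m _).eq, ← h.comm_pow_left, commutatorElement_def]; group
    calc (x * y) ^ (m + 1) = x ^ m * y ^ m * ⁅y, x⁆ ^ (m.choose 2) * (x * y) := by
          rw [pow_succ, ih]
      _ = x ^ m * (y ^ m * x) * y * ⁅y, x⁆ ^ (m.choose 2) := by
          rw [mul_assoc (x ^ m * y ^ m), (hc _ _).eq]; simp only [mul_assoc]
      _ = x ^ m * x * (y ^ m * (⁅y, x⁆ ^ m * y)) * ⁅y, x⁆ ^ (m.choose 2) := by
          rw [e]; simp only [mul_assoc]
      _ = x ^ (m + 1) * y ^ (m + 1) * ⁅y, x⁆ ^ ((m + 1).choose 2) := by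
          rw [(hc m y).eq, Nat.choose_succ_succ' m 1, Nat.choose_one_right, pow_add ⁅y, x⁆,
            pow_succ x, pow_succ y]
          simp only [mul_assoc]

/-- In a group of class at most two, elements of exponent `N` generate a group of exponent
`2 * N`. -/
theorem exp_closure {S : Set K} {N : ℕ} (hS : ∀ s ∈ S, s ^ N = 1) :
    IsNil2Exp (2 * N) (Subgroup.closure S) := by
  have h1 : ∀ x ∈ Subgroup.closure S, ∀ y : K, ⁅x, y⁆ ^ N = 1 := by
    intro x hx
    induction hx using Subgroup.closure_induction with
    | mem s hs => intro y; rw [← h.comm_pow_left, hS s hs]; simp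
    | one => simp
    | mul a b _ _ ha hb =>
      intro y
      rw [h.comm_mul_left, Commute.mul_pow (h.comm _ _ _), ha, hb, one_mul]
    | inv a _ ha => intro y; rw [h.comm_inv_left, inv_pow, ha, inv_one]
  have h2 : ∀ x ∈ Subgroup.closure S, x ^ (2 * N) = 1 := by
    intro x hx
    induction hx using Subgroup.closure_induction with
    | mem s hs => rw [mul_comm, pow_mul, hS s hs, one_pow]
    | one => simp
    | mul a b _ hbS ha hb =>
      -- Doubling N pays off here: N divides C(2N, 2), which kills the commutator factor of
      -- (ab)^(2N).
      have e : (2 * N).choose 2 = N * (2 * N - 1) := by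
        rw [Nat.choose_two_right, mul_assoc, Nat.mul_div_cancel_left _ two_pos]
      rw [h.mul_pow, ha, hb, e, pow_mul, h1 b hbS, one_pow, one_mul, one_mul]
    | inv a _ ha => rw [inv_pow, ha, inv_one]
  exact ⟨h.of_injective _ (Subgroup.subtype_injective _), fun x => Subtype.ext (h2 x x.2)⟩

end IsNil2

/-! ### Twisting a group by a bilinear central cocycle -/

/-- A bilinear map from a group to its center that is trivial on its own values. -/
structure CentralPairing (H : Type*) [Group H] where
  toFun : H → H → H
  comm' : ∀ x y z, toFun x y * z = z * toFun x y
  mul_left' : ∀ x y z, toFun (x * y) z = toFun x z * toFun y z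
  mul_right' : ∀ x y z, toFun x (y * z) = toFun x y * toFun x z
  left_trivial : ∀ x y z, toFun (toFun x y) z = 1
  right_trivial : ∀ x y z, toFun x (toFun y z) = 1

/-- The group `H` with multiplication changed by a central pairing. -/
@[ext] structure Twisted {H : Type*} [Group H] (b : CentralPairing H) where
  el : H

namespace Twisted

variable {H : Type*} [Group H] (b : CentralPairing H)

theorem pairing_one_left (x : H) : b.toFun 1 x = 1 := by
  have := b.mul_left' 1 1 x
  simpa using this

theorem pairing_one_right (x : H) : b.toFun x 1 = 1 := by
  have := b.mul_right' x 1 1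
  simpa using this

theorem pairing_inv_left (x y : H) : b.toFun x⁻¹ y = (b.toFun x y)⁻¹ := by
  rw [eq_inv_iff_mul_eq_one, ← b.mul_left', inv_mul_cancel, pairing_one_left]

theorem pairing_inv_right (x y : H) : b.toFun x y⁻¹ = (b.toFun x y)⁻¹ := by
  rw [eq_inv_iff_mul_eq_one, ← b.mul_right', inv_mul_cancel, pairing_one_right]

theorem pairing_commutator_left (x y z : H) : b.toFun ⁅x, y⁆ z = 1 := by
  simp only [commutatorElement_def, b.mul_left', pairing_inv_left]
  rw [b.comm' x, mul_assoc, mul_assoc, ← mul_assoc (b.toFun x _)]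
  simp

theorem pairing_commutator_right (x y z : H) : b.toFun z ⁅x, y⁆ = 1 := by
  simp only [commutatorElement_def, b.mul_right', pairing_inv_right]
  rw [b.comm' z x, mul_assoc, mul_assoc, ← mul_assoc (b.toFun z x)]
  simp

instance : Mul (Twisted b) := ⟨fun x y => ⟨x.el * y.el * b.toFun x.el y.el⟩⟩
instance : One (Twisted b) := ⟨⟨1⟩⟩
instance : Inv (Twisted b) := ⟨fun x => ⟨x.el⁻¹ * b.toFun x.el x.el⟩⟩

theorem mul_el (x y : Twisted b) : (x * y).el = x.el * y.el * b.toFun x.el y.el := rfl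
theorem one_el : (1 : Twisted b).el = 1 := rfl
theorem inv_el (x : Twisted b) : (x⁻¹).el = x.el⁻¹ * b.toFun x.el x.el := rfl

instance : Group (Twisted b) :=
  Group.ofLeftAxioms
    (fun x y z => by
      ext
      simp only [mul_el, b.mul_left', b.mul_right', b.left_trivial, b.right_trivial, mul_one]
      calc x.el * y.el * b.toFun x.el y.el * z.el * (b.toFun x.el z.el * b.toFun y.el z.el)
          = x.el * y.el * (b.toFun x.el y.el * (z.el * (b.toFun x.el z.el * b.toFun y.el z.el))) := by
            simp only [mul_assoc]
        _ = x.el * y.el * z.el * (b.toFun x.el z.el * b.toFun y.el z.el * b.toFun x.el y.el) := by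
            rw [b.comm']; simp only [mul_assoc]
        _ = _ := by
            rw [← b.comm' x.el y.el, b.comm' x.el z.el (b.toFun y.el z.el), ← mul_assoc (b.toFun x.el y.el),
              b.comm' x.el y.el (b.toFun y.el z.el)]
            simp only [mul_assoc])
    (fun x => by ext; simp [mul_el, one_el, pairing_one_left])
    (fun x => by
      ext
      simp [mul_el, one_el, inv_el, b.mul_left', b.left_trivial, pairing_inv_left, b.comm',
        mul_assoc])

theorem comm_el (x y : Twisted b) :
    (⁅x, y⁆ : Twisted b).el = ⁅x.el, y.el⁆ * (b.toFun x.el y.el * (b.toFun y.el x.el)⁻¹) := by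
  set t : Twisted b := ⟨⁅x.el, y.el⁆ * (b.toFun x.el y.el * (b.toFun y.el x.el)⁻¹)⟩ with ht
  suffices t * (y * x) = x * y by
    rw [commutatorElement_def, mul_assoc, ← mul_inv_rev, ← this, mul_inv_cancel_right]
  ext
  have h1 : b.toFun t.el (y * x).el = 1 := by
    simp only [ht, b.mul_left', pairing_inv_left, b.left_trivial, pairing_commutator_left]
    simp
  rw [mul_el, h1, mul_el, mul_el, mul_one, ht]
  rw [commutatorElement_def]
  have hc : ∀ z, b.toFun x.el y.el * (b.toFun y.el x.el)⁻¹ * z =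
      z * (b.toFun x.el y.el * (b.toFun y.el x.el)⁻¹) := by
    intro z
    have : Commute (b.toFun y.el x.el)⁻¹ z := Commute.inv_left (b.comm' _ _ z)
    exact Commute.mul_left (b.comm' _ _ z) this
  rw [mul_assoc _ (b.toFun x.el y.el * _), hc, b.comm' x.el]
  group

theorem isNil2 (h : IsNil2 H) : IsNil2 (Twisted b) := by
  refine isNil2_iff.2 fun x y z => ?_
  have h1 : ∀ w, b.toFun (⁅x, y⁆ : Twisted b).el w = 1 := by
    intro w
    rw [comm_el]
    simp only [b.mul_left', pairing_inv_left, b.left_trivial, pairing_commutator_left]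
    simp
  have h2 : ∀ w, b.toFun w (⁅x, y⁆ : Twisted b).el = 1 := by
    intro w
    rw [comm_el]
    simp only [b.mul_right', pairing_inv_right, b.right_trivial, pairing_commutator_right]
    simp
  ext
  rw [mul_el, mul_el, h1, h2, comm_el, mul_one, mul_one]
  have : Commute (b.toFun y.el x.el)⁻¹ z.el := Commute.inv_left (b.comm' _ _ _)
  exact Commute.mul_left (h.comm _ _ _) (Commute.mul_left (b.comm' _ _ _) this)

/-- A homomorphism to `H` whose range is isotropic for the pairing, as a homomorphism to the
twisted group. -/
def lift {A : Type*} [Group A] (f : A →* H) (hf : ∀ x y, b.toFun (f x) (f y) = 1) :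
    A →* Twisted b where
  toFun x := ⟨f x⟩
  map_one' := by ext; simp [one_el]
  map_mul' x y := by ext; simp [mul_el, hf]

theorem lift_el {A : Type*} [Group A] (f : A →* H) (hf : ∀ x y, b.toFun (f x) (f y) = 1) (x : A) :
    (lift b f hf x).el = f x := rfl

theorem lift_injective {A : Type*} [Group A] (f : A →* H)
    (hf : ∀ x y, b.toFun (f x) (f y) = 1) (hi : Function.Injective f) :
    Function.Injective (lift b f hf) := fun _ _ e => hi (congrArg Twisted.el e)

end Twisted

/-! ### Splitting of bounded pure subgroups -/

/-- A bounded pure `p`-subgroup of an abelian group is a direct factor. -/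
theorem exists_retraction_of_pure {G A : Type*} [AddCommGroup G] [AddCommGroup A] (f : G →+ A)
    (p k : ℕ) (hp : p.Prime) (hk : ∀ g : G, p ^ k • g = 0)
    (hpure : ∀ (j : ℕ) (a : A) (g : G), p ^ j • a = f g → ∃ g', g = p ^ j • g') :
    ∃ r : A →+ G, ∀ g, r (f g) = g := by
  classical
  -- Membership in `P` says that f stays pure modulo X. A maximal such X will be the complement of
  -- the image.
  let P : Set (AddSubgroup A) :=
    {X | ∀ (j : ℕ) (a : A) (g : G), p ^ j • a - f g ∈ X → ∃ g', g = p ^ j • g'}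
  obtain ⟨X, hXP, hXmax⟩ : ∃ X, X ∈ P ∧ ∀ Y ∈ P, X ≤ Y → Y ≤ X := by
    obtain ⟨X, hX⟩ := zorn_le_nonempty₀ P (by
      intro c hc hchain Y hY
      refine ⟨sSup c, ?_, fun Z hZ => le_sSup hZ⟩
      intro j a g hag
      rw [AddSubgroup.mem_sSup_of_directedOn ⟨Y, hY⟩ hchain.directedOn] at hag
      obtain ⟨Z, hZ, hag⟩ := hag
      exact hc hZ j a g hag) ⊥ (by
        intro j a g hag
        exact hpure j a g (sub_eq_zero.1 (by simpa using hag)))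
    exact ⟨X, hX.2.prop, fun Y hY hXY => hX.2.le_of_ge hY hXY⟩
  -- Purity at j = k with a = 0: g is a p^k-th multiple, hence zero. This also yields injectivity of
  -- f.
  have hdisj : ∀ g, f g ∈ X → g = 0 := by
    intro g hg
    obtain ⟨g', rfl⟩ := hXP k 0 g (by simpa using hg)
    exact hk g'
  have hkX : ∀ a : A, p ^ k • a ∈ X := by
    let Y : AddSubgroup A := (nsmulAddMonoidHom (α := A) (p ^ k)).range
    have hY : X ⊔ Y ∈ P := by
      intro j a g hag
      obtain ⟨x, hx, y, ⟨c, rfl⟩, e⟩ := AddSubgroup.mem_sup.1 hag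
      simp only [nsmulAddMonoidHom_apply] at e
      rcases le_total j k with hjk | hjk
      · obtain ⟨d, rfl⟩ := Nat.exists_eq_add_of_le hjk
        apply hXP j (a - p ^ d • c) g
        have : p ^ j • (a - p ^ d • c) - f g = x := by
          rw [nsmul_sub, ← mul_nsmul', ← pow_add, sub_right_comm, ← e]; abel
        rwa [this]
      · obtain ⟨d, rfl⟩ := Nat.exists_eq_add_of_le hjk
        obtain ⟨g', rfl⟩ := hXP k (p ^ d • a - c) g (by
          have : p ^ k • (p ^ d • a - c) - f g = x := by
            rw [nsmul_sub, ← mul_nsmul', ← pow_add, sub_right_comm, ← e]; abel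
          rwa [this])
        exact ⟨0, by rw [hk]; simp⟩
    intro a
    exact hXmax _ hY le_sup_left (AddSubgroup.mem_sup_right ⟨a, rfl⟩)
  let T : AddSubgroup A := f.range ⊔ X
  have hXT : X ≤ T := le_sup_right
  have hfT : ∀ g, f g ∈ T := fun g => AddSubgroup.mem_sup_left ⟨g, rfl⟩
  have htop : ∀ a, a ∈ T := by
    by_contra! hcon
    obtain ⟨a₀, ha₀⟩ := hcon
    -- `Q h`: modulo X, some class of order p outside the image has height at least h. Heights are
    -- bounded by k, so one of maximal height can be added to X without losing purity.
    let Q : ℕ → Prop := fun h => ∃ a, a ∉ T ∧ p • a ∈ X ∧ ∃ b, a - p ^ h • b ∈ X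
    have hQ0 : Q 0 := by
      have hex : ∃ m, p ^ m • a₀ ∈ T := ⟨k, hXT (hkX a₀)⟩
      set m := Nat.find hex with hm
      have hmT : p ^ m • a₀ ∈ T := Nat.find_spec hex
      have hm0 : m ≠ 0 := by
        intro h0; rw [h0] at hmT; simp at hmT; exact ha₀ hmT
      obtain ⟨l, hl⟩ := Nat.exists_eq_succ_of_ne_zero hm0
      have hlT : p ^ l • a₀ ∉ T := Nat.find_min hex (by omega)
      rw [hl, pow_succ', mul_nsmul'] at hmT
      obtain ⟨_, ⟨g, rfl⟩, x, hx, e⟩ := AddSubgroup.mem_sup.1 hmT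
      obtain ⟨g', rfl⟩ := hXP 1 (p ^ l • a₀) g (by
        rw [pow_one, ← e]; simpa using hx)
      refine ⟨p ^ l • a₀ - f g', fun h => hlT ?_, ?_, p ^ l • a₀ - f g', by simp⟩
      · simpa using T.add_mem h (hfT g')
      · rw [nsmul_sub, ← e]; simpa using hx
    have hQk : ∀ h, Q h → h ≤ k := by
      rintro h ⟨a, haT, -, b, hb⟩
      by_contra! hlt
      obtain ⟨d, rfl⟩ := Nat.exists_eq_add_of_le hlt.le
      apply haT
      apply hXT
      have := X.add_mem hb (hkX (p ^ d • b))
      rw [← mul_nsmul', ← pow_add] at this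
      simpa using this
    set h := Nat.findGreatest Q k with hh
    obtain ⟨a, haT, hpa, b, hb⟩ : Q h := Nat.findGreatest_spec (Nat.zero_le k) hQ0
    have hmax : ∀ j, h < j → ¬ Q j := fun j hj hQj =>
      absurd (Nat.le_findGreatest (hQk j hQj) hQj) (by omega)
    have hpaz : ∀ t : ℤ, ((p : ℤ) * t) • a ∈ X := fun t => by
      rw [mul_zsmul, natCast_zsmul, smul_comm]
      exact X.zsmul_mem hpa t
    have hY : X ⊔ AddSubgroup.zmultiples a ∈ P := by
      intro j y g hag
      obtain ⟨x, hx, _, ⟨m, rfl⟩, e⟩ := AddSubgroup.mem_sup.1 hag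
      simp only at e
      by_cases hpm : (p : ℤ) ∣ m
      · obtain ⟨t, rfl⟩ := hpm
        exact hXP j y g (by rw [← e]; exact X.add_mem hx (hpaz t))
      rcases le_or_gt j h with hjh | hjh
      · obtain ⟨d, hd⟩ := Nat.exists_eq_add_of_le hjh
        apply hXP j (y - m • p ^ d • b) g
        have : p ^ j • (y - m • p ^ d • b) - f g = x + m • (a - p ^ h • b) := by
          rw [nsmul_sub, smul_comm (p ^ j) m, ← mul_nsmul', ← pow_add, ← hd, sub_right_comm, ← e,
            zsmul_sub]
          abel
        rw [this]
        exact X.add_mem hx (X.zsmul_mem hb m)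
      · exfalso
        -- Multiplying by p sends m • a into X, so purity gives p • g = p^(j+1) • g'. Then p^j • (y
        -- - f g') is a class of height at least j > h, against maximality.
        have e1 : p ^ (j + 1) • y - f (p • g) ∈ X := by
          have : p ^ (j + 1) • y - f (p • g) = p • x + ((p : ℤ) * m) • a := by
            rw [mul_zsmul, natCast_zsmul, ← nsmul_add, e, pow_succ', mul_nsmul', map_nsmul,
              nsmul_sub]
          rw [this]
          exact X.add_mem (X.nsmul_mem hx p) (hpaz m)
        obtain ⟨g', hg'⟩ := hXP _ _ _ e1
        have e2 : p ^ j • (y - f g') = f (g - p ^ j • g') + (x + m • a) := by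
          rw [e, nsmul_sub, map_sub, map_nsmul]; abel
        refine hmax j hjh ⟨p ^ j • (y - f g'), ?_, ?_, y - f g', by simp⟩
        · intro hT
          have hma : m • a ∈ T := by
            rw [e2] at hT
            have := T.sub_mem (T.sub_mem hT (hfT (g - p ^ j • g'))) (hXT hx)
            simpa using this
          have hcop : IsCoprime (p : ℤ) m :=
            (Nat.prime_iff_prime_int.1 hp).coprime_iff_not_dvd.2 hpm
          obtain ⟨s, t, hst⟩ := hcop
          apply haT
          have : a = (p * s : ℤ) • a + t • m • a := by
            rw [← mul_zsmul', mul_comm m t, ← add_zsmul, mul_comm (p : ℤ), hst, one_zsmul]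
          rw [this]
          exact T.add_mem (hXT (hpaz s)) (T.zsmul_mem hma t)
        · have : p • p ^ j • (y - f g') = p • x + ((p : ℤ) * m) • a := by
            rw [e2, nsmul_add, ← map_nsmul, nsmul_sub, hg', pow_succ', mul_nsmul', sub_self,
              map_zero, zero_add, nsmul_add, mul_zsmul, natCast_zsmul]
          rw [this]
          exact X.add_mem (X.nsmul_mem hx p) (hpaz m)
    exact haT (hXT (hXmax _ hY le_sup_left
      (AddSubgroup.mem_sup_right (AddSubgroup.mem_zmultiples a))))
  have hex : ∀ a, ∃ g, a - f g ∈ X := by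
    intro a
    obtain ⟨_, ⟨g, rfl⟩, x, hx, e⟩ := AddSubgroup.mem_sup.1 (htop a)
    exact ⟨g, by rw [← e]; simpa using hx⟩
  have huniq : ∀ a g g', a - f g ∈ X → a - f g' ∈ X → g = g' := by
    intro a g g' h1 h2
    rw [← sub_eq_zero]
    apply hdisj
    have := X.sub_mem h2 h1
    rw [map_sub]
    convert this using 1
    abel
  choose r hr using hex
  refine ⟨AddMonoidHom.mk' r fun a b => huniq (a + b) _ _ (hr _) ?_,
    fun g => huniq (f g) _ _ (hr _) (by simp)⟩
  have := X.add_mem (hr a) (hr b)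
  rw [map_add]
  convert this using 1
  abel

/-! ### Commutators with the abelianized core -/

namespace IsNil2

variable {K : Type*} [Group K]

/-- The commutator of a group of class at most two, as a bilinear map to the center. -/
def commHom (h : IsNil2 K) : K →* K →* Subgroup.center K :=
  MonoidHom.mk'
    (fun x => MonoidHom.mk' (fun y => ⟨⁅x, y⁆, h.comm_mem_center x y⟩)
      fun y z => Subtype.ext (h.comm_mul_right x y z))
    fun x y => MonoidHom.ext fun z => Subtype.ext (h.comm_mul_left x y z)

variable {B : Type*} [Group B]

/-- Commutators with elements of `B` depend only on their classes in the abelianization. -/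
def coreComm (h : IsNil2 K) (φ : B →* K) : Abelianization B →* K →* Subgroup.center K :=
  Abelianization.lift (h.commHom.comp φ)

/-- The commutator pairing on the abelianization of `B` induced by a homomorphism to `K`. -/
def coreCoreComm (h : IsNil2 K) (φ : B →* K) (β : Abelianization B) :
    Abelianization B →* Subgroup.center K :=
  Abelianization.lift ((h.coreComm φ β).comp φ)

theorem coreComm_of (h : IsNil2 K) (φ : B →* K) (g : B) (a : K) :
    (h.coreComm φ (Abelianization.of g) a : K) = ⁅φ g, a⁆ := rfl

theorem coreCoreComm_of (h : IsNil2 K) (φ : B →* K) (β : Abelianization B) (g : B) :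
    h.coreCoreComm φ β (Abelianization.of g) = h.coreComm φ β (φ g) := rfl

theorem coreCoreComm_mul (h : IsNil2 K) (φ : B →* K) (β γ δ : Abelianization B) :
    h.coreCoreComm φ (β * γ) δ = h.coreCoreComm φ β δ * h.coreCoreComm φ γ δ := by
  obtain ⟨d, rfl⟩ := QuotientGroup.mk_surjective δ
  change h.coreComm φ (β * γ) (φ d) = h.coreComm φ β (φ d) * h.coreComm φ γ (φ d)
  rw [map_mul]; rfl

theorem coreCoreComm_one (h : IsNil2 K) (φ : B →* K) (δ : Abelianization B) :
    h.coreCoreComm φ 1 δ = 1 := by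
  have := h.coreCoreComm_mul φ 1 1 δ
  simpa using this

theorem map_coreComm (h : IsNil2 K) (φ : B →* K) {V : Type*} [CommGroup V] (f : K →* V)
    (β : Abelianization B) (a : K) : f (h.coreComm φ β a) = 1 := by
  obtain ⟨d, rfl⟩ := QuotientGroup.mk_surjective β
  change f ⁅φ d, a⁆ = 1
  rw [map_commutatorElement, commutatorElement_eq_one_iff_mul_comm, mul_comm]

theorem map_coreCoreComm (h : IsNil2 K) (φ : B →* K) {V : Type*} [CommGroup V] (f : K →* V)
    (β γ : Abelianization B) : f (h.coreCoreComm φ β γ) = 1 := by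
  obtain ⟨d, rfl⟩ := QuotientGroup.mk_surjective γ
  exact h.map_coreComm φ f β (φ d)

theorem coreComm_center (h : IsNil2 K) (φ : B →* K) (β : Abelianization B) (z : K)
    (hz : z ∈ Subgroup.center K) : h.coreComm φ β z = 1 := by
  obtain ⟨d, rfl⟩ := QuotientGroup.mk_surjective β
  exact Subtype.ext (commutatorElement_eq_one_iff_mul_comm.2 (Subgroup.mem_center_iff.1 hz _))

end IsNil2

/-! ### The amalgam as a quotient of a twisted product -/

section Embedding

variable {A B C : Type u} [Group A] [Group B] [Group C] (hA : IsNil2 A) (hC : IsNil2 C)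
  (φA : B →* A) (φC : B →* C) (rA : A →* Abelianization B) (rC : C →* Abelianization B)

/-- The pairing on `A × C` that makes the complements of the core commute. -/
def amalgamPairing : CentralPairing (A × C) where
  -- Let α = rA a and γ = rC c be the core parts. If the remaining parts of a and c commute, then
  -- [c,a] = [γ,a] [γ,α]⁻¹ [c,α]: the overlap [γ,α] is counted twice and divided out once.
  toFun x y :=
    (((hA.coreComm φA (rC x.2) y.1 * (hA.coreCoreComm φA (rC x.2) (rA y.1))⁻¹ :
        Subgroup.center A) : A),
      (((hC.coreComm φC (rA y.1) x.2)⁻¹ : Subgroup.center C) : C))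
  comm' x y z := Prod.ext
    (Subgroup.mem_center_iff.1 (hA.coreComm φA (rC x.2) y.1 *
      (hA.coreCoreComm φA (rC x.2) (rA y.1))⁻¹).2 z.1).symm
    (Subgroup.mem_center_iff.1 (hC.coreComm φC (rA y.1) x.2)⁻¹.2 z.2).symm
  mul_left' x y z := by
    refine Prod.ext ?_ ?_
    · simp only [Prod.fst_mul, Prod.snd_mul, map_mul, hA.coreCoreComm_mul, MonoidHom.mul_apply,
        ← Subgroup.coe_mul]
      rw [mul_inv, mul_mul_mul_comm]
    · simp only [Prod.snd_mul, map_mul, ← Subgroup.coe_mul]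
      rw [mul_inv]
  mul_right' x y z := by
    refine Prod.ext ?_ ?_
    · simp only [Prod.fst_mul, map_mul, ← Subgroup.coe_mul]
      rw [mul_inv, mul_mul_mul_comm]
    · simp only [Prod.fst_mul, Prod.snd_mul, map_mul, MonoidHom.mul_apply, ← Subgroup.coe_mul]
      rw [mul_inv]
  left_trivial x y z := by
    refine Prod.ext ?_ ?_
    · simp only [Subgroup.coe_inv, map_inv, hC.map_coreComm, inv_one, map_one,
        MonoidHom.one_apply, hA.coreCoreComm_one, mul_one]
      rfl
    · dsimp only
      rw [hC.coreComm_center _ _ _ (Subtype.property _), inv_one]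
      rfl
  right_trivial x y z := by
    have e : rA ((hA.coreComm φA (rC y.2) z.1 * (hA.coreCoreComm φA (rC y.2) (rA z.1))⁻¹ :
        Subgroup.center A) : A) = 1 := by
      rw [Subgroup.coe_mul, Subgroup.coe_inv, map_mul, map_inv, hA.map_coreComm,
        hA.map_coreCoreComm, inv_one, mul_one]
    refine Prod.ext ?_ ?_
    · dsimp only
      rw [e, map_one, hA.coreComm_center _ _ _ (Subtype.property _), inv_one, mul_one]
      rfl
    · dsimp only
      rw [e, map_one, MonoidHom.one_apply, inv_one]
      rfl

theorem amalgamPairing_toFun (x y : A × C) :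
    (amalgamPairing hA hC φA φC rA rC).toFun x y =
      (((hA.coreComm φA (rC x.2) y.1 : A) * (hA.coreCoreComm φA (rC x.2) (rA y.1) : A)⁻¹),
        (hC.coreComm φC (rA y.1) x.2 : C)⁻¹) := rfl

variable {rA rC}

/-- The antidiagonal copy of the core. -/
def antidiagonal (hrA : ∀ g, rA (φA g) = Abelianization.of g)
    (hrC : ∀ g, rC (φC g) = Abelianization.of g) :
    B →* Twisted (amalgamPairing hA hC φA φC rA rC) :=
  MonoidHom.mk' (fun g => ⟨(φA g, φC g⁻¹)⟩) fun g h => by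
    ext
    · simp [Twisted.mul_el, amalgamPairing_toFun, hrA, hrC, IsNil2.coreCoreComm_of]
    · simp only [Twisted.mul_el, amalgamPairing_toFun, Prod.snd_mul, hrA, hC.coreComm_of]
      rw [map_inv φC g, hC.comm_inv_right, inv_inv]
      simp only [← map_commutatorElement, ← map_mul, ← map_inv]
      congr 1
      rw [commutatorElement_def]
      group

theorem antidiagonal_el (hrA : ∀ g, rA (φA g) = Abelianization.of g)
    (hrC : ∀ g, rC (φC g) = Abelianization.of g) (g : B) :
    (antidiagonal hA hC φA φC hrA hrC g).el = (φA g, φC g⁻¹) := rfl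

/-- The pairing cancels the commutators of g with the two coordinates of x and leaves the commutator
with the core element h in both. Hence the antidiagonal is normal. -/
theorem commutator_antidiagonal (hrA : ∀ g, rA (φA g) = Abelianization.of g)
    (hrC : ∀ g, rC (φC g) = Abelianization.of g)
    (x : Twisted (amalgamPairing hA hC φA φC rA rC)) (g h : B)
    (hh : Abelianization.of h = rA x.el.1) :
    ⁅x, antidiagonal hA hC φA φC hrA hrC g⁆ = antidiagonal hA hC φA φC hrA hrC ⁅h, g⁆ := by
  have hfst : ∀ p q : A × C, ⁅p, q⁆.1 = ⁅p.1, q.1⁆ := fun _ _ => rfl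
  have hsnd : ∀ p q : A × C, ⁅p, q⁆.2 = ⁅p.2, q.2⁆ := fun _ _ => rfl
  refine Twisted.ext ?_
  rw [Twisted.comm_el, antidiagonal_el, antidiagonal_el, amalgamPairing_toFun,
    amalgamPairing_toFun]
  refine Prod.ext ?_ ?_
  · simp only [Prod.fst_mul, Prod.fst_inv, hfst, hrA, hrC, ← hh, hA.coreCoreComm_of,
      hA.coreComm_of]
    rw [mul_inv_cancel, one_mul, map_inv, hA.comm_inv_left, hA.comm_inv_left, inv_inv,
      mul_inv_rev, inv_inv, commutatorElement_inv, ← hA.comm (φA g) x.el.1, ← mul_assoc,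
      ← commutatorElement_inv, inv_mul_cancel, one_mul, map_commutatorElement]
  · simp only [Prod.snd_mul, Prod.snd_inv, hsnd, hrA, ← hh, hC.coreComm_of]
    rw [map_inv, map_inv, hC.comm_inv_right, hC.comm_inv_right, inv_inv, ← mul_assoc,
      ← commutatorElement_inv x.el.2, inv_inv, inv_mul_cancel, one_mul, map_commutatorElement]

include hA hC in
/-- Amalgams in which the abelianized core splits off on both sides are strongly embeddable. -/
theorem stronglyEmbeddable_of_retraction (hrA : ∀ g, rA (φA g) = Abelianization.of g)
    (hrC : ∀ g, rC (φC g) = Abelianization.of g) (hφA : Function.Injective φA)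
    (hφC : Function.Injective φC) : StronglyEmbeddable IsNil2 φA φC := by
  let b := amalgamPairing hA hC φA φC rA rC
  let ψ := antidiagonal hA hC φA φC hrA hrC
  have hψ : ∀ g, (ψ g).el = (φA g, φC g⁻¹) := fun _ => rfl
  let N := ψ.range
  have hN : N.Normal := ⟨by
    rintro _ ⟨g, rfl⟩ x
    obtain ⟨h, hh⟩ := QuotientGroup.mk_surjective (rA x.el.1)
    refine ⟨⁅h, g⁆ * g, ?_⟩
    rw [map_mul, ← commutator_antidiagonal hA hC φA φC hrA hrC x g h hh, commutatorElement_def]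
    exact inv_mul_cancel_right _ _⟩
  let iA : A →* Twisted b := Twisted.lift b (MonoidHom.inl A C) fun x y => by
    simp [b, amalgamPairing_toFun, hA.coreCoreComm_one]
  let iC : C →* Twisted b := Twisted.lift b (MonoidHom.inr A C) fun x y => by
    simp [b, amalgamPairing_toFun]
  have hprod : ∀ a c, (iA a * iC c).el = (a, c) := by
    intro a c
    simp [iA, iC, Twisted.mul_el, Twisted.lift_el, b, amalgamPairing_toFun, hA.coreCoreComm_one]
  -- Since iA a * iC c⁻¹ is the pair (a, c⁻¹), it is antidiagonal only when a and c come from one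
  -- core element. Both injectivity and the intersection condition reduce to this.
  have hmeet : ∀ a c, QuotientGroup.mk' N (iA a) = QuotientGroup.mk' N (iC c) →
      ∃ g, a = φA g ∧ c = φC g := by
    intro a c e
    have e' : QuotientGroup.mk' N (iA a * iC c⁻¹) = 1 := by
      rw [map_mul, map_inv, e, map_inv, mul_inv_cancel]
    obtain ⟨g, hg⟩ := (QuotientGroup.eq_one_iff _).1 e'
    have := congrArg Twisted.el hg
    rw [hprod, hψ, map_inv, Prod.mk.injEq, inv_inj] at this
    exact ⟨g, this.1.symm, this.2.symm⟩
  have hglue : ∀ g, QuotientGroup.mk' N (iA (φA g)) = QuotientGroup.mk' N (iC (φC g)) := by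
    intro g
    rw [← mul_inv_eq_one, ← map_inv, ← map_mul, ← map_inv]
    refine (QuotientGroup.eq_one_iff _).2 ⟨g, ?_⟩
    ext1
    rw [hprod, ← map_inv]
    rfl
  refine ⟨Twisted b ⧸ N, inferInstance, (QuotientGroup.mk' N).comp iA,
    (QuotientGroup.mk' N).comp iC,
    (Twisted.isNil2 b (hA.prod hC)).of_surjective _ (QuotientGroup.mk'_surjective N), ?_, ?_,
    MonoidHom.ext hglue, ?_⟩
  · refine (injective_iff_map_eq_one _).2 fun a ha => ?_
    obtain ⟨g, rfl, h1⟩ := hmeet a 1 (by rw [map_one, map_one]; exact ha)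
    rw [hφC (h1.symm.trans (map_one _).symm), map_one]
  · refine (injective_iff_map_eq_one _).2 fun c hc => ?_
    obtain ⟨g, h1, rfl⟩ := hmeet 1 c (by rw [map_one, map_one]; exact hc.symm)
    rw [hφA (h1.symm.trans (map_one _).symm), map_one]
  · apply le_antisymm
    · rintro _ ⟨⟨a, rfl⟩, ⟨c, e⟩⟩
      obtain ⟨g, rfl, -⟩ := hmeet a c e.symm
      exact ⟨g, rfl⟩
    · rintro _ ⟨g, rfl⟩
      exact ⟨⟨φA g, rfl⟩, ⟨φC g, (hglue g).symm⟩⟩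

end Embedding

/-! ### Extensions with prescribed roots and commutators -/

/-- A central product of K with ℤ, in which m times the generator is identified with z; the relation
subgroup meets K trivially because m ≠ 0. -/
theorem exists_central_root {K : Type u} [Group K] (h : IsNil2 K) {z : K}
    (hz : z ∈ Subgroup.center K) {m : ℕ} (hm : m ≠ 0) :
    ∃ (L : Type u) (_ : Group L) (φ : K →* L), IsNil2 L ∧ Function.Injective φ ∧
      ∃ s ∈ Subgroup.center L, s ^ m = φ z := by
  let t : K × Multiplicative ℤ := (z, Multiplicative.ofAdd (-(m : ℤ)))
  have ht : t ∈ Subgroup.center (K × Multiplicative ℤ) :=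
    Subgroup.mem_center_iff.2 fun y => Prod.ext (Subgroup.mem_center_iff.1 hz y.1) (mul_comm _ _)
  let N := Subgroup.zpowers t
  have hN : N.Normal := ⟨fun n hn g => by
    rw [Subgroup.mem_center_iff.1 ((Subgroup.zpowers_le).2 ht hn) g, mul_inv_cancel_right]
    exact hn⟩
  refine ⟨(K × Multiplicative ℤ) ⧸ N, inferInstance,
    (QuotientGroup.mk' N).comp (MonoidHom.inl K (Multiplicative ℤ)),
    (h.prod IsNil2.of_commGroup).of_surjective _ (QuotientGroup.mk'_surjective N), ?_,
    QuotientGroup.mk' N (1, Multiplicative.ofAdd 1), ?_, ?_⟩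
  · rw [injective_iff_map_eq_one]
    intro a ha
    obtain ⟨j, hj⟩ := (QuotientGroup.eq_one_iff _).1 ha
    have h2 := congrArg (fun y => Multiplicative.toAdd (Prod.snd y)) hj
    have h1 := congrArg Prod.fst hj
    simp [t] at h1 h2
    rcases h2 with h2 | h2
    · simpa [h2] using h1.symm
    · exact absurd h2 hm
  · refine Subgroup.mem_center_iff.2 fun y => ?_
    obtain ⟨y, rfl⟩ := QuotientGroup.mk'_surjective N y
    rw [← map_mul, ← map_mul]
    congr 1
    exact Prod.ext (by simp) (mul_comm _ _)
  · rw [← map_pow]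
    refine QuotientGroup.eq.2 ⟨1, ?_⟩
    ext
    · simp [t]
    · simp [t]

theorem abelianization_of_eq_one_iff {G : Type*} [Group G] (g : G) :
    Abelianization.of g = 1 ↔ g ∈ commutator G :=
  QuotientGroup.eq_one_iff g

/-- Modulo G' the m-th powers already form a subgroup, so a single power suffices. -/
theorem mem_powMulCommutator_iff {G : Type u} [Group G] (m : ℕ) (g : G) :
    g ∈ powMulCommutator G m ↔ ∃ h, Abelianization.of g = Abelianization.of h ^ m := by
  constructor
  · intro hg
    have hle : powMulCommutator G m ≤
        ((powMonoidHom m : Abelianization G →* Abelianization G).range).comap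
          Abelianization.of := by
      refine sup_le ((Subgroup.closure_le _).2 ?_) ?_
      · rintro _ ⟨x, rfl⟩
        exact ⟨Abelianization.of x, by simp⟩
      · intro x hx
        exact ⟨1, by rw [(abelianization_of_eq_one_iff x).2 hx]; simp⟩
    obtain ⟨β, hβ⟩ := hle hg
    obtain ⟨h, rfl⟩ := QuotientGroup.mk_surjective β
    exact ⟨h, hβ.symm⟩
  · rintro ⟨h, e⟩
    have hc : (h ^ m)⁻¹ * g ∈ commutator G := by
      rw [← abelianization_of_eq_one_iff, map_mul, map_inv, map_pow, e, inv_mul_cancel]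
    rw [← mul_inv_cancel_left (h ^ m) g]
    exact mul_mem (Subgroup.mem_sup_left (Subgroup.subset_closure ⟨h, rfl⟩))
      (Subgroup.mem_sup_right hc)

theorem IsNil2.map_mem_center {G K : Type*} [Group G] [Group K] (h : IsNil2 K) (φ : G →* K)
    {z : G} (hz : z ∈ commutator G) : φ z ∈ Subgroup.center K := by
  have hle : commutator G ≤ (Subgroup.center K).comap φ := by
    rw [commutator_def, Subgroup.commutator_le]
    intro x _ y _
    rw [Subgroup.mem_comap, map_commutatorElement]
    exact h.comm_mem_center _ _
  exact hle hz

theorem pow_val_add {V : Type*} [Monoid V] {N : ℕ} [NeZero N] {v : V} (hv : v ^ N = 1)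
    (a b : ZMod N) : v ^ (a + b).val = v ^ a.val * v ^ b.val := by
  rw [ZMod.val_add, ← pow_eq_pow_mod _ hv, pow_add]

theorem pow_val_one {V : Type*} [Monoid V] {N : ℕ} {v : V} (hv : v ^ N = 1) :
    v ^ (1 : ZMod N).val = v := by
  rw [ZMod.val_one_eq_one_mod, ← pow_eq_pow_mod _ hv, pow_one]

theorem ofAdd_one_pow (N : ℕ) : (Multiplicative.ofAdd (1 : ZMod N)) ^ N = 1 := by
  rw [← ofAdd_nsmul, nsmul_one, ZMod.natCast_self, ofAdd_zero]

/-- The pairing with values the powers of a central element of exponent `N`. -/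
def centralPowPairing {K : Type*} [Group K] {z : K} (hz : z ∈ Subgroup.center K) {N : ℕ}
    [NeZero N] (hN : z ^ N = 1) :
    CentralPairing (K × Multiplicative (ZMod N) × Multiplicative (ZMod N)) where
  toFun p q := ((z ^ p.2.1.toAdd.val) ^ q.2.2.toAdd.val, 1)
  comm' p q r := Prod.ext (Subgroup.mem_center_iff.1 (pow_mem (pow_mem hz _) _) r.1).symm (by simp)
  mul_left' p q r := by
    refine Prod.ext ?_ (by simp)
    simp only [Prod.snd_mul, Prod.fst_mul, toAdd_mul, pow_val_add hN]
    rw [Commute.mul_pow (Commute.pow_pow_self z _ _)]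
  mul_right' p q r := by
    refine Prod.ext ?_ (by simp)
    simp only [Prod.snd_mul, Prod.fst_mul, toAdd_mul]
    rw [pow_val_add (by rw [← pow_mul, mul_comm, pow_mul, hN, one_pow])]
  left_trivial p q r := by simp
  right_trivial p q r := by simp

/-- A central element of exponent `N` is a commutator of elements of exponent `N` in an
extension. -/
theorem exists_commutator_eq {K : Type u} [Group K] (h : IsNil2 K) {z : K}
    (hz : z ∈ Subgroup.center K) {N : ℕ} (hN0 : N ≠ 0) (hN : z ^ N = 1) :
    ∃ (L : Type u) (_ : Group L) (φ : K →* L), IsNil2 L ∧ Function.Injective φ ∧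
      ∃ x y : L, x ^ N = 1 ∧ y ^ N = 1 ∧ ⁅x, y⁆ = φ z := by
  have : NeZero N := ⟨hN0⟩
  let M := Multiplicative (ZMod N)
  -- A Heisenberg-type cocycle z^(ij): each cyclic factor is isotropic, and the two generators have
  -- commutator z.
  let b := centralPowPairing hz hN
  have hb : ∀ p q, b.toFun p q = ((z ^ p.2.1.toAdd.val) ^ q.2.2.toAdd.val, 1) := fun _ _ => rfl
  let f₁ : M →* Twisted b := Twisted.lift b ((MonoidHom.inr K (M × M)).comp (MonoidHom.inl M M))
    fun x y => by rw [hb]; simp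
  let f₂ : M →* Twisted b := Twisted.lift b ((MonoidHom.inr K (M × M)).comp (MonoidHom.inr M M))
    fun x y => by rw [hb]; simp
  refine ⟨Twisted b, inferInstance, Twisted.lift b (MonoidHom.inl K (M × M))
    fun x y => by rw [hb]; simp, Twisted.isNil2 b (h.prod IsNil2.of_commGroup),
    Twisted.lift_injective b _ _ fun x y e => congrArg Prod.fst e,
    f₁ (Multiplicative.ofAdd 1), f₂ (Multiplicative.ofAdd 1), ?_, ?_, ?_⟩
  · rw [← map_pow, ofAdd_one_pow, map_one]
  · rw [← map_pow, ofAdd_one_pow, map_one]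
  · refine Twisted.ext ?_
    rw [Twisted.comm_el]
    simp only [f₁, f₂, Twisted.lift_el, hb]
    refine Prod.ext ?_ ?_
    · simp [commutatorElement_def, pow_val_one hN]
    · simp [commutatorElement_def]

/-- The pairing of a cyclic group with `G`, with values in an abelian group of exponent `q`. -/
def characterPairing {G W : Type*} [Group G] [CommGroup W] (χ : G →* W) {q : ℕ} [NeZero q]
    (hW : ∀ w : W, w ^ q = 1) : CentralPairing (G × W × Multiplicative (ZMod q)) where
  toFun p r := (1, χ r.1 ^ p.2.2.toAdd.val, 1)
  comm' p r s := Prod.ext (by simp) (Prod.ext (mul_comm _ _) (by simp))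
  mul_left' p r s := by
    refine Prod.ext (by simp) (Prod.ext ?_ (by simp))
    simp only [Prod.snd_mul, Prod.fst_mul, toAdd_mul, pow_val_add (hW _)]
  mul_right' p r s := by
    refine Prod.ext (by simp) (Prod.ext ?_ (by simp))
    simp only [Prod.snd_mul, Prod.fst_mul, map_mul, mul_pow]
  left_trivial p r s := by simp
  right_trivial p r s := by simp

/-- An element outside `G ^ q G'` is moved by an element of exponent `q` in an extension. -/
theorem exists_not_commute {G : Type u} [Group G] (h : IsNil2 G) {q : ℕ} (hq : q ≠ 0) {g : G}
    (hg : g ∉ powMulCommutator G q) :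
    ∃ (L : Type u) (_ : Group L) (φ : G →* L), IsNil2 L ∧ Function.Injective φ ∧
      ∃ c : L, c ^ q = 1 ∧ ⁅c, φ g⁆ ≠ 1 := by
  have : NeZero q := ⟨hq⟩
  -- The kernel of χ is G^q G'; the new cyclic generator will have commutator χ g with g.
  let R := (powMonoidHom q : Abelianization G →* Abelianization G).range
  let W := Abelianization G ⧸ R
  let χ : G →* W := (QuotientGroup.mk' R).comp Abelianization.of
  have hW : ∀ w : W, w ^ q = 1 := by
    intro w
    obtain ⟨β, rfl⟩ := QuotientGroup.mk'_surjective R w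
    rw [← map_pow]
    exact (QuotientGroup.eq_one_iff _).2 ⟨β, rfl⟩
  have hχ : χ g ≠ 1 := by
    intro e
    obtain ⟨β, hβ⟩ := (QuotientGroup.eq_one_iff _).1 e
    obtain ⟨d, rfl⟩ := QuotientGroup.mk_surjective β
    exact hg ((mem_powMulCommutator_iff q g).2 ⟨d, hβ.symm⟩)
  let M := Multiplicative (ZMod q)
  let b := characterPairing χ hW
  have hb : ∀ p r, b.toFun p r = (1, χ r.1 ^ p.2.2.toAdd.val, 1) := fun _ _ => rfl
  let f : M →* Twisted b := Twisted.lift b ((MonoidHom.inr G (W × M)).comp (MonoidHom.inr W M))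
    fun x y => by rw [hb]; simp
  refine ⟨Twisted b, inferInstance, Twisted.lift b (MonoidHom.inl G (W × M))
    fun x y => by rw [hb]; simp, Twisted.isNil2 b (h.prod IsNil2.of_commGroup),
    Twisted.lift_injective b _ _ fun x y e => congrArg Prod.fst e,
    f (Multiplicative.ofAdd 1), ?_, ?_⟩
  · rw [← map_pow, ofAdd_one_pow, map_one]
  · intro e
    have e' := congrArg (fun t => t.el.2.1) e
    rw [Twisted.comm_el] at e'
    simp only [f, Twisted.lift_el, hb] at e'
    apply hχ
    simpa [commutatorElement_def, pow_val_one (hW _), Twisted.one_el] using e'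

/-! ### From the root condition to retractions -/

theorem exists_retraction {G A : Type u} [Group G] [Group A] {n : ℕ}
    (hG : IsNil2Exp (2 ^ (n + 1)) G) (hz : commutator G = Subgroup.center G)
    (hroot : ∀ (g : G) (i : ℕ), 1 ≤ i → i ≤ n →
      g ∈ powMulCommutator G (2 ^ i) ∨ ¬ HasRootInNil2Extension (2 ^ i) g)
    (hA : IsNil2 A) (φ : G →* A) (hφ : Function.Injective φ) :
    ∃ r : A →* Abelianization G, ∀ g, r (φ g) = Abelianization.of g := by
  have hpure : ∀ (j : ℕ) (a : A) (g : G),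
      Abelianization.of a ^ 2 ^ j = Abelianization.of (φ g) →
      ∃ h, Abelianization.of g = Abelianization.of h ^ 2 ^ j := by
    intro j a g e
    have ht : (a ^ 2 ^ j)⁻¹ * φ g ∈ commutator A := by
      rw [← abelianization_of_eq_one_iff, map_mul, map_inv, map_pow, e, inv_mul_cancel]
    set t := (a ^ 2 ^ j)⁻¹ * φ g with htdef
    have hgt : φ g = a ^ 2 ^ j * t := by rw [htdef, mul_inv_cancel_left]
    have htc : t ∈ Subgroup.center A := hA ht
    rcases Nat.eq_zero_or_pos j with rfl | hj
    · exact ⟨g, by simp⟩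
    rcases le_or_gt j n with hjn | hjn
    · rw [← mem_powMulCommutator_iff]
      refine (hroot g j hj hjn).resolve_right (not_not.2 ?_)
      -- Absorbing the central error t into a central root s turns a root modulo A' into a genuine
      -- root, to which the root condition applies.
      obtain ⟨L, _, ι, hL, hι, s, hs, hst⟩ := exists_central_root hA htc (m := 2 ^ j) (by simp)
      refine ⟨L, inferInstance, ι.comp φ, hL, hι.comp hφ, ι a * s, ?_⟩
      rw [Commute.mul_pow (Subgroup.mem_center_iff.1 hs (ι a)), hst, ← map_pow, ← map_mul, ← hgt]
      rfl
    -- For j > n, [φ g, φ h] = [a, φ h ^ 2^j] = 1 by the exponent of G, so g is central and hence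
    -- lies in G'.
    · refine ⟨1, ?_⟩
      rw [map_one, one_pow, abelianization_of_eq_one_iff, hz, Subgroup.mem_center_iff]
      intro h
      apply hφ
      have hh : h ^ 2 ^ j = 1 := by
        obtain ⟨d, rfl⟩ := Nat.exists_eq_add_of_le (Nat.succ_le_of_lt hjn)
        rw [pow_add, pow_mul, Nat.succ_eq_add_one, hG.2, one_pow]
      rw [map_mul, map_mul, eq_comm, ← commutatorElement_eq_one_iff_mul_comm, hgt,
        hA.comm_mul_left, hA.comm_pow_left, ← hA.comm_pow_right, ← map_pow, hh, map_one,
        commutatorElement_one_right, one_mul, commutatorElement_eq_one_iff_mul_comm]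
      exact (Subgroup.mem_center_iff.1 htc _).symm
  obtain ⟨r, hr⟩ := exists_retraction_of_pure
    (MonoidHom.toAdditive (Abelianization.map φ)) 2 (n + 1) Nat.prime_two
    (fun g => by
      obtain ⟨g, rfl⟩ := QuotientGroup.mk_surjective g.toMul
      change Abelianization.of g ^ 2 ^ (n + 1) = 1
      rw [← map_pow, hG.2, map_one])
    (fun j a g e => by
      obtain ⟨a, rfl⟩ := QuotientGroup.mk_surjective a.toMul
      obtain ⟨g, rfl⟩ := QuotientGroup.mk_surjective g.toMul
      obtain ⟨h, hh⟩ := hpure j a g e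
      exact ⟨Additive.ofMul (Abelianization.of h), hh⟩)
  exact ⟨(MonoidHom.toAdditive.symm r).comp Abelianization.of,
    fun g => hr (Additive.ofMul (Abelianization.of g))⟩

/-! ### From weak embeddability to the root condition -/

/-- Cutting down to subgroups generated by G and elements of exponent N brings arbitrary class-two
extensions within the exponent bound 2N. -/
theorem exists_amalgam {G K L : Type u} [Group G] [Group K] [Group L] {N : ℕ}
    (hG : ∀ x : G, x ^ N = 1) (hemb : AmalgamsWeaklyEmbed (IsNil2Exp (2 * N)) IsNil2 G)
    (hK : IsNil2 K) (hL : IsNil2 L) (φ : G →* K) (ψ : G →* L) (hφ : Function.Injective φ)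
    (hψ : Function.Injective ψ) (S : Set K) (T : Set L) (hS : ∀ s ∈ S, s ^ N = 1)
    (hT : ∀ t ∈ T, t ^ N = 1) :
    ∃ (M : Type u) (_ : Group M) (lK : Subgroup.closure (Set.range φ ∪ S) →* M)
      (lL : Subgroup.closure (Set.range ψ ∪ T) →* M), IsNil2 M ∧ Function.Injective lL ∧
      ∀ g, lK ⟨φ g, Subgroup.subset_closure (Or.inl ⟨g, rfl⟩)⟩ =
        lL ⟨ψ g, Subgroup.subset_closure (Or.inl ⟨g, rfl⟩)⟩ := by
  obtain ⟨M, _, lK, lL, hM, -, hi, he⟩ := hemb (Subgroup.closure (Set.range φ ∪ S))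
    (Subgroup.closure (Set.range ψ ∪ T))
    (φ.codRestrict _ fun g => Subgroup.subset_closure (Or.inl ⟨g, rfl⟩))
    (ψ.codRestrict _ fun g => Subgroup.subset_closure (Or.inl ⟨g, rfl⟩))
    (hK.exp_closure (by
      rintro _ (⟨g, rfl⟩ | hs)
      · rw [← map_pow, hG, map_one]
      · exact hS _ hs))
    (hL.exp_closure (by
      rintro _ (⟨g, rfl⟩ | ht)
      · rw [← map_pow, hG, map_one]
      · exact hT _ ht))
    (fun x y e => hφ (congrArg Subtype.val e)) (fun x y e => hψ (congrArg Subtype.val e))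
  exact ⟨M, inferInstance, lK, lL, hM, hi, fun g => DFunLike.congr_fun he g⟩

/-- If `G` has weakly embeddable amalgams, roots modulo a commutator of bounded exponent exist
already in `G`. -/
theorem mem_powMulCommutator_of_root {G K : Type u} [Group G] [Group K] {N q : ℕ}
    (hG : IsNil2Exp N G) (hemb : AmalgamsWeaklyEmbed (IsNil2Exp (2 * N)) IsNil2 G)
    (hq : q ≠ 0) (hqN : q ∣ N) (hK : IsNil2 K) (φ : G →* K) (hφ : Function.Injective φ)
    {a x y : K} (ha : a ^ N = 1) (hx : x ^ N = 1) (hy : y ^ N = 1) {g : G}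
    (hg : φ g * ⁅x, y⁆ = a ^ q) : g ∈ powMulCommutator G q := by
  by_contra hgq
  obtain ⟨L, _, ψ, hL, hψ, c, hcq, hc⟩ := exists_not_commute hG.1 hq hgq
  have hcN : c ^ N = 1 := by
    obtain ⟨d, rfl⟩ := hqN
    rw [pow_mul, hcq, one_pow]
  obtain ⟨M, _, lK, lL, hM, hi, he⟩ := exists_amalgam hG.2 hemb hK hL φ ψ hφ hψ {a, x, y} {c}
    (by rintro s (rfl | rfl | rfl) <;> assumption) (by rintro t rfl; assumption)
  let a' : Subgroup.closure (Set.range φ ∪ {a, x, y}) :=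
    ⟨a, Subgroup.subset_closure (by simp)⟩
  let x' : Subgroup.closure (Set.range φ ∪ {a, x, y}) :=
    ⟨x, Subgroup.subset_closure (by simp)⟩
  let y' : Subgroup.closure (Set.range φ ∪ {a, x, y}) :=
    ⟨y, Subgroup.subset_closure (by simp)⟩
  let c' : Subgroup.closure (Set.range ψ ∪ {c}) := ⟨c, Subgroup.subset_closure (by simp)⟩
  have hg' : (⟨φ g, Subgroup.subset_closure (Or.inl ⟨g, rfl⟩)⟩ :
      Subgroup.closure (Set.range φ ∪ {a, x, y})) = a' ^ q * ⁅x', y'⁆⁻¹ := by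
    rw [eq_mul_inv_iff_mul_eq]
    exact Subtype.ext hg
  -- In M the factor [x,y] is central, so [c,g] = [c,a^q] = [c^q,a] = 1.
  have hcomm : ⁅lL c', lL ⟨ψ g, Subgroup.subset_closure (Or.inl ⟨g, rfl⟩)⟩⁆ = 1 := by
    have hcq' : c' ^ q = 1 := Subtype.ext hcq
    rw [← he, hg', map_mul, map_inv, map_pow, hM.comm_mul_right, hM.comm_pow_right,
      ← hM.comm_pow_left, ← map_pow, hcq', map_one, commutatorElement_one_left, one_mul,
      hM.comm_inv_right, map_commutatorElement, inv_eq_one, commutatorElement_eq_one_iff_mul_comm,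
      hM.comm]
  rw [← map_commutatorElement] at hcomm
  exact hc (congrArg Subtype.val (hi (hcomm.trans (map_one lL).symm)))

/-- A central z⁻¹ becomes a commutator [x,y], so z [x,y] = 1 = 1^N; the root criterion with q = N
puts z in G^N G' = G'. -/
theorem commutator_eq_center_of_embed {G : Type u} [Group G] {N : ℕ} (hN : N ≠ 0)
    (hG : IsNil2Exp N G) (hemb : AmalgamsWeaklyEmbed (IsNil2Exp (2 * N)) IsNil2 G) :
    commutator G = Subgroup.center G := by
  refine le_antisymm hG.1 fun z hz => ?_
  obtain ⟨L, _, φ, hL, hφ, x, y, hx, hy, e⟩ :=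
    exists_commutator_eq hG.1 (inv_mem hz) hN (hG.2 z⁻¹)
  have hmem : z ∈ powMulCommutator G N :=
    mem_powMulCommutator_of_root (a := 1) hG hemb hN dvd_rfl hL φ hφ (one_pow N) hx hy
      (by rw [e, ← map_mul, mul_inv_cancel, map_one, one_pow])
  obtain ⟨h, e⟩ := (mem_powMulCommutator_iff N z).1 hmem
  rw [← abelianization_of_eq_one_iff, e, ← map_pow, hG.2, map_one]

/-- A root r of g need not have exponent N = qm, since r^N = g^m. But g^m is central, so a central s
with s^N = g^(-m) can be adjoined. Then rs has exponent N and (rs)^q = g s^q, where s^q has exponent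
N and can be made a commutator. -/
theorem mem_powMulCommutator_of_hasRoot {G : Type u} [Group G] {q m : ℕ} (hN : q * m ≠ 0)
    (hG : IsNil2Exp (q * m) G) (hemb : AmalgamsWeaklyEmbed (IsNil2Exp (2 * (q * m))) IsNil2 G)
    {g : G} (hroot : HasRootInNil2Extension q g) : g ∈ powMulCommutator G q := by
  have hcen := commutator_eq_center_of_embed hN hG hemb
  obtain ⟨K, _, φ, hK, hφ, r, hr⟩ := hroot
  have hrN : r ^ (q * m) = φ (g ^ m) := by rw [pow_mul, hr, map_pow]
  have hz : g ^ m ∈ commutator G := by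
    rw [hcen, Subgroup.mem_center_iff]
    intro h
    apply hφ
    rw [map_mul, map_mul, eq_comm, ← commutatorElement_eq_one_iff_mul_comm, ← hrN,
      hK.comm_pow_left, ← hK.comm_pow_right, ← map_pow, hG.2, map_one,
      commutatorElement_one_right]
  obtain ⟨L, _, ι, hL, hι, s, hs, hsN⟩ :=
    exists_central_root hK (inv_mem (hK.map_mem_center φ hz)) hN
  have hw : (s ^ q) ^ (q * m) = 1 := by
    rw [← pow_mul, mul_comm, pow_mul, hsN, ← map_pow, ← map_inv, ← map_pow, inv_pow, ← pow_mul,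
      mul_comm m, hG.2, inv_one, map_one, map_one]
  obtain ⟨E, _, κ, hE, hκ, x, y, hx, hy, e⟩ := exists_commutator_eq hL (pow_mem hs q) hN hw
  have hcomm : ∀ k, (ι r * s) ^ k = ι (r ^ k) * s ^ k := fun k => by
    rw [Commute.mul_pow (Subgroup.mem_center_iff.1 hs (ι r)), map_pow]
  refine mem_powMulCommutator_of_root hG hemb (left_ne_zero_of_mul hN) (dvd_mul_right q m) hE
    ((κ.comp ι).comp φ) ((hκ.comp hι).comp hφ) (a := κ (ι r * s)) ?_ hx hy ?_
  · rw [← map_pow, hcomm, hsN, hrN, ← map_mul, mul_inv_cancel, map_one, map_one]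
  · rw [e, ← map_pow, hcomm, hr, map_mul]
    rfl

theorem mainTheorem6 (G : Type u) [Group G] (n : ℕ) (hn : 0 < n)
    (hG : IsNil2Exp (2 ^ (n + 1)) G) :
    List.TFAE
      [IsWeakBase IsNil2 G,
        AmalgamsWeaklyEmbed (IsNil2Exp (2 ^ (n + 2))) IsNil2 G,
        commutator G = Subgroup.center G ∧
          ∀ (g : G) (i : ℕ), 1 ≤ i → i ≤ n →
            g ∈ powMulCommutator G (2 ^ i) ∨ ¬ HasRootInNil2Extension (2 ^ i) g,
        AmalgamsStronglyEmbed (IsNil2Exp (2 ^ (n + 2))) IsNil2 G,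
        IsStrongBase IsNil2 G] := by
  tfae_have 1 → 2 := fun h A C _ _ φA φC hA hC => h.2 A C φA φC hA.1 hC.1
  tfae_have 2 → 3 := by
    intro h
    have e : 2 ^ (n + 2) = 2 * 2 ^ (n + 1) := by ring
    rw [e] at h
    refine ⟨commutator_eq_center_of_embed (by simp) hG h, fun g i _ hi => ?_⟩
    by_cases hr : HasRootInNil2Extension (2 ^ i) g
    · left
      have e' : 2 ^ (n + 1) = 2 ^ i * 2 ^ (n + 1 - i) := by
        rw [← pow_add, Nat.add_sub_cancel' (by omega)]
      rw [e'] at h hG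
      exact mem_powMulCommutator_of_hasRoot (by simp) hG h hr
    · exact Or.inr hr
  tfae_have 3 → 5 := by
    rintro ⟨hz, hroot⟩
    refine ⟨hG.1, fun A C _ _ φA φC hA hC hφA hφC => ?_⟩
    obtain ⟨rA, hrA⟩ := exists_retraction hG hz hroot hA φA hφA
    obtain ⟨rC, hrC⟩ := exists_retraction hG hz hroot hC φC hφC
    exact stronglyEmbeddable_of_retraction hA hC φA φC hrA hrC hφA hφC
  tfae_have 5 → 4 := fun h A C _ _ φA φC hA hC => h.2 A C φA φC hA.1 hC.1
  tfae_have 4 → 2 := fun h A C _ _ φA φC hA hC iA iC => by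
    obtain ⟨M, _, lA, lC, h1, h2, h3, h4, -⟩ := h A C φA φC hA hC iA iC
    exact ⟨M, inferInstance, lA, lC, h1, h2, h3, h4⟩
  tfae_have 5 → 1 := fun h => ⟨h.1, fun A C _ _ φA φC hA hC iA iC => by
    obtain ⟨M, _, lA, lC, h1, h2, h3, h4, -⟩ := h.2 A C φA φC hA hC iA iC
    exact ⟨M, inferInstance, lA, lC, h1, h2, h3, h4⟩⟩
  tfae_finish
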